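/- Consider an ordered GI/M/$\infty$ system. The inter-arrival times are i.i.d. copies of $T_0\ge 0$ with $\mathrm{E}\,T_0=1/\lambda$, $0<\lambda<\mu<\infty$. The servers are numbered $1,2,\dots$, service at server $n$ is exponential with rate $\mu_n>0$, all service and inter-arrival times are independent, and every arriving customer joins the idle server of least index and stays there until his service ends. The rates have total capacity $\sum_{n\ge1}\mu_n=\mu$, but they are not assumed to be ordered. Let $\mathbf X=(X_1,X_2,\dots)$ be the busy indicators of the servers found by an arriving customer, in the limit along the sequence of arrivals (started from an empty system; probabilities of events that depend on finitely many servers converge). Put $$p_n=\mathrm P(X_1=\dots=X_n=1),\qquad Y=\inf\{i:X_i=0\},\qquad q_n=\mathrm P(Y=n)=p_{n-1}-p_n\quad(p_0:=1),$$ so that the expected delay is $\mathrm{E}\,S=\sum_{n\ge1} q_n/\mu_n\in[0,\infty]$. Call the series $\{\mu_n\}_{n\ge1}$ feasible if $$\lambda p_n<\sum_{i\ge n+1}\mu_i\quad\text{for all } n\ge1,$$ and let $\mathcal M$ be the set of all feasible series of positive rates with sum $\mu$. **Lemma.** Every optimal solution of the program $$\min_{\{\mu_n\}\in\mathcal M}\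 \sum_{n=1}^\infty \frac{q_n}{\mu_n},$$ that is, every $\{\mu_n\}\in\mathcal M$ at which the minimum over $\mathcal M$ is attained with a finite value, is a non-increasing series: $\mu_1\ge\mu_2\ge\cdots$. -/

import Mathlib

open MeasureTheory Filter Topology

noncomputable section

namespace OrderedServers

/-!
An infinite ordered GI/M/∞ system. Servers are indexed by `0, 1, 2, …` (so index `n` here is
server number `n + 1`), server `i` is exponential with rate `r i`, the inter-arrival times are
i.i.d. with law `F`, and an arriving customer joins the idle server of least index.
A state is the finite set of busy servers found by an arriving customer.
-/

/-- The idle server of least index. As `S` is finite, there is one. -/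
def firstIdle (S : Finset ℕ) : ℕ := sInf {i : ℕ | i ∉ S}

/-- The set of busy servers just after an arrival that found the set `S` busy. -/
def afterArrival (S : Finset ℕ) : Finset ℕ := insert (firstIdle S) S

/-- Transition probability of the embedded chain at arrival epochs: an arrival finds the busy set
`S`, and the next arrival finds the busy set `U`. Given the inter-arrival time `t`, each server
that is busy after the first arrival is still busy with probability `exp (-(r i * t))`,
independently of the others. -/
def trans (F : Measure ℝ) (r : ℕ → ℝ) (S U : Finset ℕ) : ℝ :=
  if U ⊆ afterArrival S then
    ∫ t, (∏ i ∈ U, Real.exp (-(r i * t))) *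
      (∏ i ∈ afterArrival S \ U, (1 - Real.exp (-(r i * t)))) ∂F
  else 0

/-- `probAt F r A k S` is the probability that the state found by the `k`-th next arrival lies in
the event `A`, given that the present arrival finds the state `S`. -/
def probAt (F : Measure ℝ) (r : ℕ → ℝ) (A : Set (Finset ℕ)) : ℕ → Finset ℕ → ℝ
  | 0, S => A.indicator (fun _ => 1) S
  | k + 1, S => ∑ U ∈ (afterArrival S).powerset, trans F r S U * probAt F r A k U

/-- The limiting probability of the event `A` at arrival epochs (starting from an empty system). -/
def limitProb (F : Measure ℝ) (r : ℕ → ℝ) (A : Set (Finset ℕ)) : ℝ :=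
  limUnder atTop (fun k : ℕ => probAt F r A k ∅)

/-- `p_n`: the blocking probability of the sub-system of the first `n` servers, i.e. the limiting
probability that an arrival finds the first `n` servers all busy. -/
def blockingProb (F : Measure ℝ) (r : ℕ → ℝ) (n : ℕ) : ℝ :=
  limitProb F r {S | ∀ i < n, i ∈ S}

/-- `q_{n+1}`: the limiting probability that the first idle server found by an arrival is the one
of index `n` (server number `n + 1`). -/
def joinProb (F : Measure ℝ) (r : ℕ → ℝ) (n : ℕ) : ℝ :=
  limitProb F r {S | firstIdle S = n}

/-- The expected delay `E S = ∑ q_n / μ_n`, with value in `[0, ∞]`. -/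
def expectedDelay (F : Measure ℝ) (r : ℕ → ℝ) : ENNReal :=
  ∑' n : ℕ, ENNReal.ofReal (joinProb F r n / r n)

/-- Feasible service-rate series, for arrival rate `lam` and total capacity `cap`. The series is
not assumed to be monotone. -/
structure Feasible (F : Measure ℝ) (lam cap : ℝ) (r : ℕ → ℝ) : Prop where
  pos : ∀ n, 0 < r n
  total : HasSum r cap
  stable : ∀ n, 1 ≤ n → lam * blockingProb F r n < ∑' i : ℕ, r (n + i)

/-- `r` solves the delay-minimisation program: it is feasible, and it attains the minimum of the
expected delay over the feasible series, the minimum being finite. -/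
structure IsOptimal (F : Measure ℝ) (lam cap : ℝ) (r : ℕ → ℝ) : Prop where
  feasible : Feasible F lam cap r
  finite : expectedDelay F r < ⊤
  le : ∀ r' : ℕ → ℝ, Feasible F lam cap r' → expectedDelay F r ≤ expectedDelay F r'

end OrderedServers

end

open MeasureTheory Filter Topology

/-! The proof is an exchange argument. If `r n < r (n + 1)`, interchanging these two rates keeps the
series feasible and strictly lowers the finite delay, so the series was not optimal. Let φ be the
Laplace-Stieltjes transform of `F` and b_i the limiting probability that server i is busy just after
an arrival. An arrival finds i busy with probability φ(r_i) b_i, and b_i exceeds this by the joining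
probability, so i contributes g(r_i) b_i to the delay, where g(s) = (1 - φ(s))/s. By strict
convexity of exp, g is strictly decreasing (`one_sub_lst_div_lt`). The b_i of the two systems are
compared by the coupling `SwapRel`, which survives arrivals (`SwapRel.afterArrival`) and departures
(`thin_le_thin_of_swapRel`). With the faster server first, b_i does not grow for any server outside
the pair, the sum of b_i over the pair does not grow, and b_i of the slow server strictly falls
(`postProb_exchange_lt`). As g is larger at the slow rate, the contribution of the pair strictly
falls (`joinProb_div_exchange_pair_lt`). The exchange shrinks a tail of capacity only between the
two servers; there the constraint follows from the next one (`Feasible.exchange`). -/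

namespace OrderedServers

/-! ### Independent thinning of finite sets -/

/-- Expectation of `f` over the random subset of `V` that keeps `i` with probability `p i`,
independently. -/
noncomputable def thin (p : ℕ → ℝ) (V : Finset ℕ) (f : Finset ℕ → ℝ) : ℝ :=
  ∑ U ∈ V.powerset, (∏ i ∈ U, p i) * (∏ i ∈ V \ U, (1 - p i)) * f U

theorem thin_insert (p : ℕ → ℝ) {V : Finset ℕ} {a : ℕ} (ha : a ∉ V) (f : Finset ℕ → ℝ) :
    thin p (insert a V) f =
      p a * thin p V (fun U => f (insert a U)) + (1 - p a) * thin p V f := by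
  unfold thin
  rw [Finset.sum_powerset_insert ha, add_comm, Finset.mul_sum, Finset.mul_sum]
  congr 1
  · refine Finset.sum_congr rfl fun U hU => ?_
    have hU' := Finset.mem_powerset.1 hU
    have haU : a ∉ U := fun h => ha (hU' h)
    have hsd : insert a V \ insert a U = V \ U := by
      ext i; simp only [Finset.mem_sdiff, Finset.mem_insert]
      constructor
      · rintro ⟨h1, h2⟩; exact ⟨h1.resolve_left fun h => h2 (Or.inl h), fun h => h2 (Or.inr h)⟩
      · rintro ⟨h1, h2⟩
        exact ⟨Or.inr h1, fun h => h.elim (fun h => ha (h ▸ h1)) h2⟩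
    rw [Finset.prod_insert haU, hsd]
    ring
  · refine Finset.sum_congr rfl fun U hU => ?_
    have hU' := Finset.mem_powerset.1 hU
    have haU : a ∉ U := fun h => ha (hU' h)
    rw [Finset.insert_sdiff_of_notMem _ haU,
      Finset.prod_insert (fun h => ha (Finset.mem_sdiff.1 h).1)]
    ring

theorem thin_congr (p : ℕ → ℝ) {V : Finset ℕ} {f g : Finset ℕ → ℝ} (h : ∀ U ⊆ V, f U = g U) :
    thin p V f = thin p V g :=
  Finset.sum_congr rfl fun U hU => by rw [h U (Finset.mem_powerset.1 hU)]

theorem thin_mono {p : ℕ → ℝ} (hp : ∀ i, 0 ≤ p i ∧ p i ≤ 1) {V : Finset ℕ}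
    {f g : Finset ℕ → ℝ} (h : ∀ U ⊆ V, f U ≤ g U) : thin p V f ≤ thin p V g :=
  Finset.sum_le_sum fun U hU => mul_le_mul_of_nonneg_left (h U (Finset.mem_powerset.1 hU))
    (mul_nonneg (Finset.prod_nonneg fun i _ => (hp i).1)
      (Finset.prod_nonneg fun i _ => sub_nonneg.2 (hp i).2))

/-- Giving absent servers survival probability 0 puts the thinnings of two different busy sets on
one ground set, where they can be coupled server by server. -/
theorem thin_eq_of_subset (p : ℕ → ℝ) {V Z : Finset ℕ} (h : V ⊆ Z) (f : Finset ℕ → ℝ) :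
    thin p V f = thin (fun i => if i ∈ V then p i else 0) Z f := by
  unfold thin
  rw [← Finset.sum_subset (Finset.powerset_mono.2 h)]
  · refine Finset.sum_congr rfl fun U hU => ?_
    have hU' := Finset.mem_powerset.1 hU
    congr 2
    · exact Finset.prod_congr rfl fun i hi => by simp only [if_pos (hU' hi)]
    · rw [← Finset.prod_subset (Finset.sdiff_subset_sdiff h (subset_refl U))]
      · exact Finset.prod_congr rfl fun i hi => by simp only [if_pos (Finset.mem_sdiff.1 hi).1]
      · intro i hi hi'
        have hV : i ∉ V := fun hV => hi' (Finset.mem_sdiff.2 ⟨hV, (Finset.mem_sdiff.1 hi).2⟩)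
        simp only [if_neg hV, sub_zero]
  · intro U _ hU
    rw [Finset.mem_powerset, Finset.not_subset] at hU
    obtain ⟨i, hi, hiV⟩ := hU
    rw [Finset.prod_eq_zero hi (by rw [if_neg hiV])]
    simp

theorem thin_prod (p : ℕ → ℝ) (V : Finset ℕ) (a b : ℕ → ℝ) :
    thin p V (fun U => (∏ i ∈ U, a i) * ∏ i ∈ V \ U, b i) =
      ∏ i ∈ V, (p i * a i + (1 - p i) * b i) := by
  rw [Finset.prod_add]
  refine Finset.sum_congr rfl fun U _ => ?_
  rw [Finset.prod_mul_distrib, Finset.prod_mul_distrib]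
  ring

theorem thin_mem (p : ℕ → ℝ) (V : Finset ℕ) (a : ℕ) :
    thin p V (fun U => if a ∈ U then 1 else 0) = if a ∈ V then p a else 0 := by
  have h1 : ∀ W, thin p W (fun _ => 1) = 1 := by
    intro W
    have := thin_prod p W (fun _ => 1) (fun _ => 1)
    simpa using this
  have h0 : ∀ W, thin p W (fun _ => 0) = 0 := fun W => by simp [thin]
  split_ifs with h
  · rw [← Finset.insert_erase h, thin_insert p (Finset.notMem_erase a V)]
    simp only [Finset.mem_insert_self, if_true, h1]
    rw [thin_congr p (g := fun _ => 0), h0]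
    · ring
    · intro U hU; rw [if_neg]; exact fun h => Finset.notMem_erase a V (hU h)
  · rw [thin_congr p (g := fun _ => 0), h0]
    intro U hU; rw [if_neg]; exact fun h' => h (hU h')

/-- Stochastic comparison of two independent thinnings, coupled so that inclusion on `W` holds. -/
theorem thin_le_thin_of_prob_le {pA pB : ℕ → ℝ} (W : Set ℕ) (Z : Finset ℕ)
    (hA : ∀ i ∈ Z, 0 ≤ pA i ∧ pA i ≤ 1) (hB : ∀ i ∈ Z, 0 ≤ pB i ∧ pB i ≤ 1)
    (hAB : ∀ i ∈ Z, i ∈ W → pB i ≤ pA i) (fA fB : Finset ℕ → ℝ)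
    (hf : ∀ UA ⊆ Z, ∀ UB ⊆ Z, (∀ i ∈ W, i ∈ UB → i ∈ UA) → fB UB ≤ fA UA) :
    thin pB Z fB ≤ thin pA Z fA := by
  induction Z using Finset.induction_on generalizing fA fB with
  | empty => simpa [thin] using hf ∅ (by simp) ∅ (by simp) (by simp)
  | insert a Z ha ih =>
    rw [thin_insert _ ha, thin_insert _ ha]
    have sub := Finset.subset_insert a Z
    have ih' := ih (fun i hi => hA i (sub hi)) (fun i hi => hB i (sub hi))
      (fun i hi => hAB i (sub hi))
    have h00 := ih' fA fB fun UA hUA UB hUB h =>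
      hf UA (hUA.trans sub) UB (hUB.trans sub) h
    have h11 := ih' (fun U => fA (insert a U)) (fun U => fB (insert a U))
      fun UA hUA UB hUB h =>
        hf _ (Finset.insert_subset_insert a hUA) _ (Finset.insert_subset_insert a hUB)
          fun i hi hiB => by
            rw [Finset.mem_insert] at hiB ⊢; exact hiB.imp id (h i hi)
    have h10 := ih' (fun U => fA (insert a U)) fB
      fun UA hUA UB hUB h =>
        hf _ (Finset.insert_subset_insert a hUA) _ (hUB.trans sub)
          fun i hi hiB => Finset.mem_insert_of_mem (h i hi hiB)
    obtain ⟨a0, a1⟩ := hA a (Finset.mem_insert_self a Z)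
    obtain ⟨b0, b1⟩ := hB a (Finset.mem_insert_self a Z)
    by_cases haW : a ∈ W
    · have hab := hAB a (Finset.mem_insert_self a Z) haW
      -- One uniform variable drives `a` in both systems: it survives in both with weight `pB a`, in
      -- A only with `pA a - pB a`, in neither with `1 - pA a`.
      nlinarith [mul_nonneg b0 (sub_nonneg.2 h11),
        mul_nonneg (sub_nonneg.2 hab) (sub_nonneg.2 h10),
        mul_nonneg (sub_nonneg.2 a1) (sub_nonneg.2 h00)]
    · have h01 := ih' fA (fun U => fB (insert a U))
        fun UA hUA UB hUB h =>
          hf _ (hUA.trans sub) _ (Finset.insert_subset_insert a hUB)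
            fun i hi hiB => by
              rcases Finset.mem_insert.1 hiB with rfl | hiB
              · exact absurd hi haW
              · exact h i hi hiB
      -- Off `W` nothing is required of `a`, so its two survivals may be independent.
      nlinarith [mul_nonneg (mul_nonneg b0 a0) (sub_nonneg.2 h11),
        mul_nonneg (mul_nonneg (sub_nonneg.2 b1) a0) (sub_nonneg.2 h10),
        mul_nonneg (mul_nonneg b0 (sub_nonneg.2 a1)) (sub_nonneg.2 h01),
        mul_nonneg (mul_nonneg (sub_nonneg.2 b1) (sub_nonneg.2 a1)) (sub_nonneg.2 h00)]

theorem thin_le_thin_of_inter_subset {pA pB : ℕ → ℝ} (hA : ∀ i, 0 ≤ pA i ∧ pA i ≤ 1)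
    (hB : ∀ i, 0 ≤ pB i ∧ pB i ≤ 1) (W : Set ℕ) (hAB : ∀ i ∈ W, pB i ≤ pA i)
    {VA VB : Finset ℕ} (hV : ∀ i ∈ W, i ∈ VB → i ∈ VA) {fA fB : Finset ℕ → ℝ}
    (hf : ∀ UA UB : Finset ℕ, (∀ i ∈ W, i ∈ UB → i ∈ UA) → fB UB ≤ fA UA) :
    thin pB VB fB ≤ thin pA VA fA := by
  rw [thin_eq_of_subset pA (Finset.subset_union_left (s₂ := VB)),
    thin_eq_of_subset pB (Finset.subset_union_right (s₁ := VA))]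
  refine thin_le_thin_of_prob_le W _ ?_ ?_ ?_ _ _ fun UA _ UB _ => hf UA UB
  · intro i _; split_ifs
    exacts [hA i, by norm_num]
  · intro i _; split_ifs
    exacts [hB i, by norm_num]
  · intro i _ hi; split_ifs with h1 h2 h2
    exacts [hAB i hi, absurd (hV i hi h1) h2, (hA i).1, le_rfl]

/-! ### Coupling of two systems that differ by an adjacent exchange -/

/-- The coupling relation for exchanging servers `n` and `n + 1`: `SA` is the busy set when the
slower one comes first, `SB` the busy set when the faster one comes first. -/
structure SwapRel (n : ℕ) (SA SB : Finset ℕ) : Prop where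
  off : ∀ i, i ≠ n → i ≠ n + 1 → i ∈ SB → i ∈ SA
  slow : n + 1 ∈ SB → n ∈ SA
  fast : n ∈ SB → n ∈ SA ∨ n + 1 ∈ SA
  both : n ∈ SB → n + 1 ∈ SB → n + 1 ∈ SA

theorem SwapRel.union {n : ℕ} {a b UA UB : Finset ℕ} (h : SwapRel n a b)
    (ha : ∀ i ∈ b, i = n ∨ i = n + 1) (hB0 : n ∉ UB) (hB1 : n + 1 ∉ UB) (hU : UB ⊆ UA) :
    SwapRel n (a ∪ UA) (b ∪ UB) := by
  constructor
  · intro i h0 h1 hi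
    rcases Finset.mem_union.1 hi with hi | hi
    · exact absurd (ha i hi) (by tauto)
    · exact Finset.mem_union_right _ (hU hi)
  · intro hi
    exact Finset.mem_union_left _ (h.slow ((Finset.mem_union.1 hi).resolve_right hB1))
  · intro hi
    exact (h.fast ((Finset.mem_union.1 hi).resolve_right hB0)).imp
      (Finset.mem_union_left _) (Finset.mem_union_left _)
  · intro hi hi'
    exact Finset.mem_union_left _ (h.both ((Finset.mem_union.1 hi).resolve_right hB0)
      ((Finset.mem_union.1 hi').resolve_right hB1))

theorem thin_pair (p : ℕ → ℝ) {Z : Finset ℕ} {n : ℕ} (h0 : n ∉ Z) (h1 : n + 1 ∉ Z)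
    (f : Finset ℕ → ℝ) :
    thin p (insert n (insert (n + 1) Z)) f =
      p n * (p (n + 1) * thin p Z (fun U => f ({n, n + 1} ∪ U)) +
        (1 - p (n + 1)) * thin p Z (fun U => f ({n} ∪ U))) +
      (1 - p n) * (p (n + 1) * thin p Z (fun U => f ({n + 1} ∪ U)) +
        (1 - p (n + 1)) * thin p Z (fun U => f (∅ ∪ U))) := by
  rw [thin_insert p (by simp [h0]), thin_insert p h1, thin_insert p h1]
  simp only [Finset.insert_union, Finset.empty_union, Finset.singleton_union]

/-- Comparison of the two survival patterns of a pair of servers with survival probabilities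
`s` (slow) and `f` (fast). The propositions say which servers are busy in the two systems. -/
theorem pair_mixture_le {s f a00 af as a2 b00 bf bs b2 : ℝ} (s0 : 0 ≤ s) (s1 : s ≤ 1)
    (f0 : 0 ≤ f) (f1 : f ≤ 1) (hle : f ≤ s)
    (e00 : b00 ≤ a00) (e0s : b00 ≤ as) (e0f : b00 ≤ af) (e02 : b00 ≤ a2) (efs : bf ≤ as)
    (eff : bf ≤ af) (ef2 : bf ≤ a2) (ess : bs ≤ as) (es2 : bs ≤ a2) (e22 : b2 ≤ a2)
    (A0 A1 B0 B1 : Prop) [Decidable A0] [Decidable A1] [Decidable B0] [Decidable B1]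
    (hslow : B1 → A0) (hfast : B0 → A0 ∨ A1) (hboth : B0 → B1 → A1) :
    (if B0 then f else 0) * ((if B1 then s else 0) * b2 + (1 - if B1 then s else 0) * bf) +
      (1 - if B0 then f else 0) * ((if B1 then s else 0) * bs +
        (1 - if B1 then s else 0) * b00) ≤
    (if A0 then s else 0) * ((if A1 then f else 0) * a2 + (1 - if A1 then f else 0) * as) +
      (1 - if A0 then s else 0) * ((if A1 then f else 0) * af +
        (1 - if A1 then f else 0) * a00) := by
  have s1' := sub_nonneg.2 s1
  have f1' := sub_nonneg.2 f1
  have hle' := sub_nonneg.2 hle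
  have sf := mul_nonneg s0 f0
  have sf' := mul_nonneg s0 f1'
  have s'f := mul_nonneg s1' f0
  have s'f' := mul_nonneg s1' f1'
  rw [← sub_nonneg] at e00 e0s e0f e02 efs eff ef2 ess es2 e22
  by_cases c1 : B0 <;> by_cases c2 : B1 <;> by_cases c3 : A0 <;> by_cases c4 : A1 <;>
    first
    | exact absurd (hslow c2) c3
    | exact absurd (hboth c1 c2) c4
    | exact absurd (hfast c1) (not_or.2 ⟨c3, c4⟩)
    | simp only [c1, c2, c3, c4, if_true, if_false]
  -- The slow servers share their survival, and so do the fast ones. The one exception is the third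
  -- case: only the fast server is busy in B and only the slow one in A, and the survival of the
  -- former is nested in that of the latter, with weights `f`, `s - f`, `1 - s`.
  · linarith [mul_nonneg sf e22, mul_nonneg sf' ess, mul_nonneg s'f eff, mul_nonneg s'f' e00]
  · linarith [mul_nonneg sf ef2, mul_nonneg sf' e0s, mul_nonneg s'f eff, mul_nonneg s'f' e00]
  · linarith [mul_nonneg f0 efs, mul_nonneg hle' e0s, mul_nonneg s1' e00]
  · linarith [mul_nonneg f0 eff, mul_nonneg f1' e00]
  · linarith [mul_nonneg sf es2, mul_nonneg sf' ess, mul_nonneg s'f e0f, mul_nonneg s'f' e00]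
  · linarith [mul_nonneg s0 ess, mul_nonneg s1' e00]
  · linarith [mul_nonneg sf e02, mul_nonneg sf' e0s, mul_nonneg s'f e0f, mul_nonneg s'f' e00]
  · linarith [mul_nonneg s0 e0s, mul_nonneg s1' e00]
  · linarith [mul_nonneg f0 e0f, mul_nonneg f1' e00]
  · linarith

/-- The survival of the pair is separated from that of the other servers. Given an admissible
outcome for the pair, the others are coupled by inclusion (`key`); averaging over the pair is
`pair_mixture_le`. -/
theorem thin_le_thin_of_swapRel {pA pB : ℕ → ℝ} (hA : ∀ i, 0 ≤ pA i ∧ pA i ≤ 1)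
    (hB : ∀ i, 0 ≤ pB i ∧ pB i ≤ 1) {n : ℕ} (hoff : ∀ i, i ≠ n → i ≠ n + 1 → pB i = pA i)
    (hslow : pB (n + 1) = pA n) (hfast : pB n = pA (n + 1)) (hle : pA (n + 1) ≤ pA n)
    {VA VB : Finset ℕ} (hV : SwapRel n VA VB) {fA fB : Finset ℕ → ℝ}
    (hf : ∀ UA UB : Finset ℕ, SwapRel n UA UB → fB UB ≤ fA UA) :
    thin pB VB fB ≤ thin pA VA fA := by
  set Z : Finset ℕ := ((VA ∪ VB).erase n).erase (n + 1) with hZ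
  have hn : n ∉ Z := by simp [hZ]
  have hn1 : n + 1 ∉ Z := by simp [hZ]
  have sub : VA ∪ VB ⊆ insert n (insert (n + 1) Z) := by
    intro i hi
    simp only [hZ, Finset.mem_insert, Finset.mem_erase, ne_eq]
    tauto
  have key : ∀ a b : Finset ℕ, SwapRel n a b → (∀ i ∈ b, i = n ∨ i = n + 1) →
      thin (fun i => if i ∈ VB then pB i else 0) Z (fun U => fB (b ∪ U)) ≤
        thin (fun i => if i ∈ VA then pA i else 0) Z (fun U => fA (a ∪ U)) := by
    intro a b hab hb
    refine thin_le_thin_of_prob_le Set.univ Z ?_ ?_ ?_ _ _ ?_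
    · intro i _; split_ifs
      exacts [hA i, by norm_num]
    · intro i _; split_ifs
      exacts [hB i, by norm_num]
    · intro i hi _
      have h0 : i ≠ n := fun h => hn (h ▸ hi)
      have h1 : i ≠ n + 1 := fun h => hn1 (h ▸ hi)
      split_ifs with h2 h3 h3
      exacts [(hoff i h0 h1).le, absurd (hV.off i h0 h1 h2) h3, (hA i).1, le_rfl]
    · intro UA _ UB hUB h
      exact hf _ _ (hab.union hb (fun h => hn (hUB h)) (fun h => hn1 (hUB h))
        fun i hi => h i trivial hi)
  rw [thin_eq_of_subset pA (Finset.subset_union_left.trans sub),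
    thin_eq_of_subset pB (Finset.subset_union_right.trans sub),
    thin_pair _ hn hn1, thin_pair _ hn hn1]
  simp only [hslow, hfast]
  refine pair_mixture_le (hA n).1 (hA n).2 (hA (n + 1)).1 (hA (n + 1)).2 hle
    (key _ _ ?_ ?_) (key _ _ ?_ ?_) (key _ _ ?_ ?_) (key _ _ ?_ ?_) (key _ _ ?_ ?_)
    (key _ _ ?_ ?_) (key _ _ ?_ ?_) (key _ _ ?_ ?_) (key _ _ ?_ ?_) (key _ _ ?_ ?_)
    _ _ _ _ hV.slow hV.fast hV.both
  -- The ten inequalities correspond to the ten pairs of subsets of `{n, n + 1}` that are related by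
  -- `SwapRel`.
  all_goals first
    | (constructor <;> simp +contextual)
    | simp +contextual

/-! ### The effect of an arrival on the coupling -/

theorem firstIdle_notMem (S : Finset ℕ) : firstIdle S ∉ S :=
  Nat.sInf_mem (s := {i : ℕ | i ∉ S}) (Infinite.exists_notMem_finset S)

theorem mem_of_lt_firstIdle {S : Finset ℕ} {i : ℕ} (h : i < firstIdle S) : i ∈ S := by
  by_contra hi
  exact Nat.notMem_of_lt_sInf h hi

theorem firstIdle_eq_iff {S : Finset ℕ} {n : ℕ} :
    firstIdle S = n ↔ (∀ i < n, i ∈ S) ∧ n ∉ S := by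
  constructor
  · rintro rfl
    exact ⟨fun i hi => mem_of_lt_firstIdle hi, firstIdle_notMem S⟩
  · rintro ⟨h1, h2⟩
    rcases lt_trichotomy (firstIdle S) n with h | h | h
    exacts [absurd (h1 _ h) (firstIdle_notMem S), h, absurd (mem_of_lt_firstIdle h) h2]

theorem mem_afterArrival {S : Finset ℕ} {i : ℕ} :
    i ∈ afterArrival S ↔ i ∈ S ∨ ∀ j < i, j ∈ S := by
  rw [afterArrival, Finset.mem_insert, eq_comm, firstIdle_eq_iff]
  tauto

/-- An initial block of servers evolves autonomously: whether an arrival makes `i` busy depends only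
on the servers before `i`. Hence `W` must be a lower set. -/
theorem afterArrival_inter_subset {W : Set ℕ} (hW : IsLowerSet W) {SA SB : Finset ℕ}
    (h : ∀ i ∈ W, i ∈ SB → i ∈ SA) : ∀ i ∈ W, i ∈ afterArrival SB → i ∈ afterArrival SA := by
  intro i hi
  rw [mem_afterArrival, mem_afterArrival]
  exact Or.imp (h i hi) fun hj j hji => h j (hW hji.le hi) (hj j hji)

/-- A server becomes busy exactly when all earlier ones are busy. The clauses of `SwapRel` carry a
full prefix in B to A as long as it does not end between the two servers; if it ends there, `fast`
leaves A either with `n + 1` already busy or with a full prefix that sends the customer there. -/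
theorem SwapRel.afterArrival {n : ℕ} {SA SB : Finset ℕ} (h : SwapRel n SA SB) :
    SwapRel n (afterArrival SA) (afterArrival SB) := by
  obtain ⟨off, slow, fast, both⟩ := h
  have low : (∀ j < n, j ∈ SB) → ∀ j < n, j ∈ SA := fun h j hj =>
    off j (by omega) (by omega) (h j hj)
  constructor
  · intro i h0 h1
    simp only [mem_afterArrival]
    refine Or.imp (off i h0 h1) fun hB j hj => ?_
    by_cases c0 : j = n
    · subst c0; exact slow (hB _ (by omega))
    by_cases c1 : j = n + 1
    · subst c1; exact both (hB _ (by omega)) (hB _ hj)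
    exact off j c0 c1 (hB j hj)
  · simp only [mem_afterArrival]
    exact Or.imp slow fun hB => low fun j hj => hB j (by omega)
  · simp only [mem_afterArrival]
    rintro (hB | hB)
    · exact (fast hB).imp Or.inl Or.inl
    · exact Or.inl (Or.inr (low hB))
  · simp only [mem_afterArrival]
    intro h0 h1
    have split : (∀ j < n, j ∈ SA) → n ∈ SA → ∀ j < n + 1, j ∈ SA := fun h h' j hj => by
      rcases Nat.lt_succ_iff_lt_or_eq.1 hj with hj | rfl
      exacts [h j hj, h']
    rcases h1 with h1 | h1
    · rcases h0 with h0 | h0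
      · exact Or.inl (both h0 h1)
      · exact Or.inr (split (low h0) (slow h1))
    · have hl := low fun j hj => h1 j (by omega)
      rcases fast (h1 n (by omega)) with h2 | h2
      · exact Or.inr (split hl h2)
      · exact Or.inl h2

/-! ### The embedded chain and its monotonicity -/

/-- Transition operator of the embedded chain. -/
noncomputable def step (F : Measure ℝ) (r : ℕ → ℝ) (f : Finset ℕ → ℝ) (S : Finset ℕ) : ℝ :=
  ∑ U ∈ (afterArrival S).powerset, trans F r S U * f U

/-- Expected value of `f` at the state found by the `k`-th next arrival. -/
noncomputable def expAt (F : Measure ℝ) (r : ℕ → ℝ) (f : Finset ℕ → ℝ) : ℕ → Finset ℕ → ℝ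
  | 0 => f
  | k + 1 => step F r (expAt F r f k)

theorem probAt_eq_expAt (F : Measure ℝ) (r : ℕ → ℝ) (A : Set (Finset ℕ)) (k : ℕ) :
    probAt F r A k = expAt F r (A.indicator fun _ => 1) k := by
  induction k with
  | zero => rfl
  | succ k ih => funext S; simp only [probAt, expAt, step, ih]

/-- Splits off the last transition, whereas the definition splits off the first. -/
theorem expAt_succ (F : Measure ℝ) (r : ℕ → ℝ) (f : Finset ℕ → ℝ) (k : ℕ) :
    expAt F r f (k + 1) = expAt F r (step F r f) k := by
  induction k with
  | zero => rfl
  | succ k ih => rw [expAt, ih]; rfl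

theorem expAt_add (F : Measure ℝ) (r : ℕ → ℝ) (f g : Finset ℕ → ℝ) (k : ℕ) (S : Finset ℕ) :
    expAt F r (fun S => f S + g S) k S = expAt F r f k S + expAt F r g k S := by
  induction k generalizing S with
  | zero => rfl
  | succ k ih => simp only [expAt, step, ih, mul_add, Finset.sum_add_distrib]

theorem expAt_const_mul (F : Measure ℝ) (r : ℕ → ℝ) (c : ℝ) (f : Finset ℕ → ℝ) (k : ℕ)
    (S : Finset ℕ) : expAt F r (fun S => c * f S) k S = c * expAt F r f k S := by
  induction k generalizing S with
  | zero => rfl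
  | succ k ih => simp only [expAt, step, ih, Finset.mul_sum, mul_left_comm]

theorem exp_mem_unit {r t : ℝ} (hr : 0 < r) (ht : 0 ≤ t) :
    0 ≤ Real.exp (-(r * t)) ∧ Real.exp (-(r * t)) ≤ 1 :=
  ⟨(Real.exp_pos _).le, Real.exp_le_one_iff.2 (by nlinarith [mul_nonneg hr.le ht])⟩

section
variable {F : Measure ℝ} [IsProbabilityMeasure F]

theorem integrable_prod_survival (hF : ∀ᵐ t ∂F, 0 ≤ t) {r : ℕ → ℝ} (hr : ∀ i, 0 < r i)
    (U V : Finset ℕ) :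
    Integrable (fun t => (∏ i ∈ U, Real.exp (-(r i * t))) *
      ∏ i ∈ V, (1 - Real.exp (-(r i * t)))) F := by
  refine Integrable.of_bound (C := 1) (by fun_prop) ?_
  filter_upwards [hF] with t ht
  have h := fun i => exp_mem_unit (hr i) ht
  rw [Real.norm_of_nonneg]
  · refine mul_le_one₀ ?_ ?_ ?_
    · exact Finset.prod_le_one (fun i _ => (h i).1) fun i _ => (h i).2
    · exact Finset.prod_nonneg fun i _ => sub_nonneg.2 (h i).2
    · exact Finset.prod_le_one (fun i _ => sub_nonneg.2 (h i).2) fun i _ => by linarith [(h i).1]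
  · exact mul_nonneg (Finset.prod_nonneg fun i _ => (h i).1)
      (Finset.prod_nonneg fun i _ => sub_nonneg.2 (h i).2)

theorem integrable_thin (hF : ∀ᵐ t ∂F, 0 ≤ t) {r : ℕ → ℝ} (hr : ∀ i, 0 < r i)
    (V : Finset ℕ) (f : Finset ℕ → ℝ) :
    Integrable (fun t => thin (fun i => Real.exp (-(r i * t))) V f) F :=
  integrable_finsetSum _ fun U _ => (integrable_prod_survival hF hr U (V \ U)).mul_const _

theorem step_eq_integral (hF : ∀ᵐ t ∂F, 0 ≤ t) {r : ℕ → ℝ} (hr : ∀ i, 0 < r i)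
    (f : Finset ℕ → ℝ) (S : Finset ℕ) :
    step F r f S = ∫ t, thin (fun i => Real.exp (-(r i * t))) (afterArrival S) f ∂F := by
  unfold thin step
  rw [integral_finsetSum _ fun U _ => (integrable_prod_survival hF hr U _).mul_const _]
  refine Finset.sum_congr rfl fun U hU => ?_
  rw [trans, if_pos (Finset.mem_powerset.1 hU), integral_mul_const]

theorem step_le_step_of_inter_subset (hF : ∀ᵐ t ∂F, 0 ≤ t) {rA rB : ℕ → ℝ}
    (hA : ∀ i, 0 < rA i) (hB : ∀ i, 0 < rB i) {W : Set ℕ} (hW : IsLowerSet W)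
    (hAB : ∀ i ∈ W, rA i ≤ rB i) {fA fB : Finset ℕ → ℝ}
    (hf : ∀ UA UB : Finset ℕ, (∀ i ∈ W, i ∈ UB → i ∈ UA) → fB UB ≤ fA UA)
    {SA SB : Finset ℕ} (h : ∀ i ∈ W, i ∈ SB → i ∈ SA) :
    step F rB fB SB ≤ step F rA fA SA := by
  rw [step_eq_integral hF hA, step_eq_integral hF hB]
  refine integral_mono_ae (integrable_thin hF hB _ _) (integrable_thin hF hA _ _) ?_
  filter_upwards [hF] with t ht
  refine thin_le_thin_of_inter_subset (fun i => exp_mem_unit (hA i) ht)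
    (fun i => exp_mem_unit (hB i) ht) W (fun i hi => ?_) (afterArrival_inter_subset hW h) hf
  exact Real.exp_le_exp.2 (neg_le_neg (mul_le_mul_of_nonneg_right (hAB i hi) ht))

theorem step_le_step_of_swapRel (hF : ∀ᵐ t ∂F, 0 ≤ t) {rA rB : ℕ → ℝ}
    (hA : ∀ i, 0 < rA i) (hB : ∀ i, 0 < rB i) {n : ℕ}
    (hoff : ∀ i, i ≠ n → i ≠ n + 1 → rB i = rA i)
    (hslow : rB (n + 1) = rA n) (hfast : rB n = rA (n + 1)) (hle : rA n ≤ rA (n + 1))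
    {fA fB : Finset ℕ → ℝ} (hf : ∀ UA UB : Finset ℕ, SwapRel n UA UB → fB UB ≤ fA UA)
    {SA SB : Finset ℕ} (h : SwapRel n SA SB) : step F rB fB SB ≤ step F rA fA SA := by
  rw [step_eq_integral hF hA, step_eq_integral hF hB]
  refine integral_mono_ae (integrable_thin hF hB _ _) (integrable_thin hF hA _ _) ?_
  filter_upwards [hF] with t ht
  refine thin_le_thin_of_swapRel (fun i => exp_mem_unit (hA i) ht)
    (fun i => exp_mem_unit (hB i) ht) (fun i h0 h1 => ?_) ?_ ?_ ?_ h.afterArrival hf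
  · simp only [hoff i h0 h1]
  · simp only [hslow]
  · simp only [hfast]
  · exact Real.exp_le_exp.2 (neg_le_neg (mul_le_mul_of_nonneg_right hle ht))

theorem expAt_le_expAt_of_inter_subset (hF : ∀ᵐ t ∂F, 0 ≤ t) {rA rB : ℕ → ℝ}
    (hA : ∀ i, 0 < rA i) (hB : ∀ i, 0 < rB i) {W : Set ℕ} (hW : IsLowerSet W)
    (hAB : ∀ i ∈ W, rA i ≤ rB i) {fA fB : Finset ℕ → ℝ}
    (hf : ∀ UA UB : Finset ℕ, (∀ i ∈ W, i ∈ UB → i ∈ UA) → fB UB ≤ fA UA) (k : ℕ)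
    {SA SB : Finset ℕ} (h : ∀ i ∈ W, i ∈ SB → i ∈ SA) :
    expAt F rB fB k SB ≤ expAt F rA fA k SA := by
  induction k generalizing SA SB with
  | zero => exact hf _ _ h
  | succ k ih => exact step_le_step_of_inter_subset hF hA hB hW hAB (fun _ _ h => ih h) h

theorem expAt_le_expAt_of_swapRel (hF : ∀ᵐ t ∂F, 0 ≤ t) {rA rB : ℕ → ℝ}
    (hA : ∀ i, 0 < rA i) (hB : ∀ i, 0 < rB i) {n : ℕ}
    (hoff : ∀ i, i ≠ n → i ≠ n + 1 → rB i = rA i)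
    (hslow : rB (n + 1) = rA n) (hfast : rB n = rA (n + 1)) (hle : rA n ≤ rA (n + 1))
    {fA fB : Finset ℕ → ℝ} (hf : ∀ UA UB : Finset ℕ, SwapRel n UA UB → fB UB ≤ fA UA) (k : ℕ)
    {SA SB : Finset ℕ} (h : SwapRel n SA SB) : expAt F rB fB k SB ≤ expAt F rA fA k SA := by
  induction k generalizing SA SB with
  | zero => exact hf _ _ h
  | succ k ih =>
    exact step_le_step_of_swapRel hF hA hB hoff hslow hfast hle (fun _ _ h => ih h) h

theorem step_mono (hF : ∀ᵐ t ∂F, 0 ≤ t) {r : ℕ → ℝ} (hr : ∀ i, 0 < r i)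
    {f g : Finset ℕ → ℝ} (h : ∀ S, f S ≤ g S) (S : Finset ℕ) : step F r f S ≤ step F r g S := by
  rw [step_eq_integral hF hr, step_eq_integral hF hr]
  refine integral_mono_ae (integrable_thin hF hr _ _) (integrable_thin hF hr _ _) ?_
  filter_upwards [hF] with t ht
  exact thin_mono (fun i => exp_mem_unit (hr i) ht) fun U _ => h U

theorem expAt_mono (hF : ∀ᵐ t ∂F, 0 ≤ t) {r : ℕ → ℝ} (hr : ∀ i, 0 < r i)
    {f g : Finset ℕ → ℝ} (h : ∀ S, f S ≤ g S) (k : ℕ) (S : Finset ℕ) :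
    expAt F r f k S ≤ expAt F r g k S := by
  induction k generalizing S with
  | zero => exact h S
  | succ k ih => exact step_mono hF hr ih S

theorem step_const (hF : ∀ᵐ t ∂F, 0 ≤ t) {r : ℕ → ℝ} (hr : ∀ i, 0 < r i) (c : ℝ)
    (S : Finset ℕ) : step F r (fun _ => c) S = c := by
  have h : ∀ p V, thin p V (fun _ => c) = c := by
    intro p V
    have := thin_prod p V (fun _ => 1) (fun _ => 1)
    simp only [thin, Finset.prod_const_one, mul_one, add_sub_cancel] at this
    rw [thin, ← Finset.sum_mul, this, one_mul]
  rw [step_eq_integral hF hr]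
  simp [h]

theorem expAt_const (hF : ∀ᵐ t ∂F, 0 ≤ t) {r : ℕ → ℝ} (hr : ∀ i, 0 < r i)
    (c : ℝ) (k : ℕ) (S : Finset ℕ) : expAt F r (fun _ => c) k S = c := by
  induction k generalizing S with
  | zero => rfl
  | succ k ih =>
    rw [expAt, funext ih]
    exact step_const hF hr c S

end

theorem integral_pos_of_frequently_pos {F : Measure ℝ} {f : ℝ → ℝ} (hf : 0 ≤ᵐ[F] f) (hi : Integrable f F)
    (h : ∃ᶠ t in ae F, 0 < f t) : 0 < ∫ t, f t ∂F := by
  refine (integral_nonneg_of_ae hf).lt_of_ne fun h0 => h ?_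
  have := (integral_eq_zero_iff_of_nonneg_ae hf hi).1 h0.symm
  filter_upwards [this] with t ht
  exact fun hlt => hlt.ne' ht

/-! ### Limiting probabilities and rate conservation -/

section
variable {F : Measure ℝ} [IsProbabilityMeasure F] {r : ℕ → ℝ}

theorem indicator_le_indicator_of_imp {A B : Set (Finset ℕ)} {S T : Finset ℕ}
    (h : S ∈ A → T ∈ B) :
    A.indicator (fun _ => (1 : ℝ)) S ≤ B.indicator (fun _ => 1) T := by
  by_cases hS : S ∈ A
  · rw [Set.indicator_of_mem hS, Set.indicator_of_mem (h hS)]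
  · rw [Set.indicator_of_notMem hS]
    exact Set.indicator_nonneg (fun _ _ => zero_le_one) T

/-- The chain is monotone in its initial state and starts from the least one, so the probability of
an up-set increases with time. -/
theorem tendsto_limitProb (hF : ∀ᵐ t ∂F, 0 ≤ t) (hr : ∀ i, 0 < r i) {A : Set (Finset ℕ)}
    (hA : IsUpperSet A) :
    Tendsto (fun k => expAt F r (A.indicator fun _ => 1) k ∅) atTop (𝓝 (limitProb F r A)) := by
  have hmono : Monotone fun k => expAt F r (A.indicator fun _ => 1) k ∅ := by
    refine monotone_nat_of_le_succ fun k => ?_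
    rw [← step_const hF hr (expAt F r (A.indicator fun _ => 1) k ∅) ∅]
    refine step_mono hF hr (fun S => ?_) ∅
    refine expAt_le_expAt_of_inter_subset hF hr hr isLowerSet_univ (fun _ _ => le_rfl)
      (fun UA UB h => ?_) k (by simp)
    exact indicator_le_indicator_of_imp (hA fun i hi => h i trivial hi)
  have hbdd : BddAbove (Set.range fun k => expAt F r (A.indicator fun _ => 1) k ∅) := by
    refine ⟨1, ?_⟩
    rintro _ ⟨k, rfl⟩
    exact (expAt_mono hF hr (g := fun _ => 1)
      (fun S => Set.indicator_le_self' (fun _ _ => zero_le_one) S) k ∅).trans_eq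
      (expAt_const hF hr 1 k ∅)
  have h := tendsto_atTop_ciSup hmono hbdd
  have : limitProb F r A = ⨆ k, expAt F r (A.indicator fun _ => 1) k ∅ := by
    unfold limitProb
    simp only [probAt_eq_expAt]
    exact h.limUnder_eq
  rwa [this]

theorem limitProb_nonneg (hF : ∀ᵐ t ∂F, 0 ≤ t) (hr : ∀ i, 0 < r i) {A : Set (Finset ℕ)}
    (hA : IsUpperSet A) : 0 ≤ limitProb F r A :=
  ge_of_tendsto' (tendsto_limitProb hF hr hA) fun k => by
    rw [← expAt_const hF hr 0 k ∅]
    exact expAt_mono hF hr (fun S => Set.indicator_nonneg (fun _ _ => zero_le_one) S) k ∅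

theorem limitProb_le_one (hF : ∀ᵐ t ∂F, 0 ≤ t) (hr : ∀ i, 0 < r i) {A : Set (Finset ℕ)}
    (hA : IsUpperSet A) : limitProb F r A ≤ 1 :=
  le_of_tendsto' (tendsto_limitProb hF hr hA) fun k => by
    exact (expAt_mono hF hr (g := fun _ => 1)
      (fun S => Set.indicator_le_self' (fun _ _ => zero_le_one) S) k ∅).trans_eq
      (expAt_const hF hr 1 k ∅)

theorem isUpperSet_firstBusy (n : ℕ) : IsUpperSet {S : Finset ℕ | ∀ i < n, i ∈ S} :=
  fun _ _ h hS i hi => h (hS i hi)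

theorem isUpperSet_busy (i : ℕ) : IsUpperSet {S : Finset ℕ | i ∈ S} := fun _ _ h hS => h hS

theorem isUpperSet_busy_afterArrival (i : ℕ) : IsUpperSet {S : Finset ℕ | i ∈ afterArrival S} := by
  intro S T h hS
  rw [Set.mem_ofPred_eq, mem_afterArrival] at hS ⊢
  exact hS.imp (fun hi => h hi) fun hj j hji => h (hj j hji)

/-- Limiting probability that an arrival finds server `i` busy. -/
noncomputable def busyProb (F : Measure ℝ) (r : ℕ → ℝ) (i : ℕ) : ℝ :=
  limitProb F r {S | i ∈ S}

/-- Limiting probability that server `i` is busy just after an arrival. -/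
noncomputable def postProb (F : Measure ℝ) (r : ℕ → ℝ) (i : ℕ) : ℝ :=
  limitProb F r {S | i ∈ afterArrival S}

/-- Laplace-Stieltjes transform of the inter-arrival law. -/
noncomputable def lst (F : Measure ℝ) (s : ℝ) : ℝ := ∫ t, Real.exp (-(s * t)) ∂F

/-- The event is not an up-set, but it is the difference of two nested ones. -/
theorem tendsto_joinProb (hF : ∀ᵐ t ∂F, 0 ≤ t) (hr : ∀ i, 0 < r i) (n : ℕ) :
    Tendsto (fun k => expAt F r (Set.indicator {S | firstIdle S = n} fun _ => 1) k ∅) atTop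
      (𝓝 (joinProb F r n)) ∧
    joinProb F r n = blockingProb F r n - blockingProb F r (n + 1) := by
  have h : ∀ k, expAt F r (Set.indicator {S | firstIdle S = n} fun _ => 1) k ∅ =
      expAt F r (Set.indicator {S | ∀ i < n, i ∈ S} fun _ => 1) k ∅ -
      expAt F r (Set.indicator {S | ∀ i < n + 1, i ∈ S} fun _ => 1) k ∅ := by
    intro k
    rw [eq_sub_iff_add_eq, ← expAt_add]
    congr 1
    funext S
    have hsucc : (∀ i < n + 1, i ∈ S) ↔ (∀ i < n, i ∈ S) ∧ n ∈ S := by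
      simp only [Nat.lt_succ_iff_lt_or_eq, or_imp, forall_and, forall_eq]
    simp only [Set.indicator_apply, Set.mem_ofPred_eq, firstIdle_eq_iff, hsucc]
    by_cases h1 : ∀ i < n, i ∈ S <;> by_cases h2 : n ∈ S <;> simp [h1, h2]
  have ht : Tendsto (fun k => expAt F r (Set.indicator {S | firstIdle S = n} fun _ => 1) k ∅)
      atTop (𝓝 (blockingProb F r n - blockingProb F r (n + 1))) := by
    simp only [h]
    exact (tendsto_limitProb hF hr (isUpperSet_firstBusy n)).sub
      (tendsto_limitProb hF hr (isUpperSet_firstBusy (n + 1)))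
  have he : joinProb F r n = blockingProb F r n - blockingProb F r (n + 1) := by
    unfold joinProb limitProb
    simp only [probAt_eq_expAt]
    exact ht.limUnder_eq
  exact ⟨he ▸ ht, he⟩

theorem postProb_eq (hF : ∀ᵐ t ∂F, 0 ≤ t) (hr : ∀ i, 0 < r i) (i : ℕ) :
    postProb F r i = busyProb F r i + joinProb F r i := by
  refine tendsto_nhds_unique (tendsto_limitProb hF hr (isUpperSet_busy_afterArrival i)) ?_
  refine ((tendsto_limitProb hF hr (isUpperSet_busy i)).add
    (tendsto_joinProb hF hr i).1).congr fun k => ?_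
  rw [← expAt_add]
  congr 1
  funext S
  simp only [Set.indicator_apply, Set.mem_ofPred_eq, firstIdle_eq_iff, mem_afterArrival]
  by_cases h1 : ∀ j < i, j ∈ S <;> by_cases h2 : i ∈ S <;> simp [h1, h2]

theorem step_busy (hF : ∀ᵐ t ∂F, 0 ≤ t) (hr : ∀ i, 0 < r i) (i : ℕ) (S : Finset ℕ) :
    step F r (Set.indicator {S | i ∈ S} fun _ => 1) S =
      lst F (r i) * Set.indicator {S | i ∈ afterArrival S} (fun _ => 1) S := by
  rw [step_eq_integral hF hr]
  have h : (Set.indicator {S : Finset ℕ | i ∈ S} fun _ => (1 : ℝ)) =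
      fun U => if i ∈ U then 1 else 0 := by
    funext U; simp [Set.indicator_apply]
  simp only [h, thin_mem, Set.indicator_apply, Set.mem_ofPred_eq]
  split_ifs <;> simp [lst]

/-- Stationarity for one server: an arrival finds it busy exactly when it was busy just after the
previous arrival and outlasted the inter-arrival time. -/
theorem busyProb_eq (hF : ∀ᵐ t ∂F, 0 ≤ t) (hr : ∀ i, 0 < r i) (i : ℕ) :
    busyProb F r i = lst F (r i) * postProb F r i := by
  refine tendsto_nhds_unique
    ((tendsto_add_atTop_iff_nat 1).2 (tendsto_limitProb hF hr (isUpperSet_busy i))) ?_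
  refine ((tendsto_limitProb hF hr (isUpperSet_busy_afterArrival i)).const_mul _).congr
    fun k => ?_
  rw [expAt_succ, funext (step_busy hF hr i), expAt_const_mul]

theorem joinProb_eq (hF : ∀ᵐ t ∂F, 0 ≤ t) (hr : ∀ i, 0 < r i) (i : ℕ) :
    joinProb F r i = (1 - lst F (r i)) * postProb F r i := by
  linarith [postProb_eq hF hr i, busyProb_eq hF hr i]

/-! ### The transform of the inter-arrival law -/

theorem integrable_exp_neg_mul (hF : ∀ᵐ t ∂F, 0 ≤ t) {s : ℝ} (hs : 0 < s) :
    Integrable (fun t => Real.exp (-(s * t))) F := by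
  simpa using integrable_prod_survival hF (r := fun _ => s) (fun _ => hs) {0} ∅

theorem lst_le_one (hF : ∀ᵐ t ∂F, 0 ≤ t) {s : ℝ} (hs : 0 < s) : lst F s ≤ 1 := by
  have := integral_mono_ae (integrable_exp_neg_mul hF hs) (integrable_const (1 : ℝ))
    (hF.mono fun t ht => (exp_mem_unit hs ht).2)
  rwa [integral_const, probReal_univ, one_smul] at this

theorem one_sub_lst_le (hF : ∀ᵐ t ∂F, 0 ≤ t) (hint : Integrable (fun t : ℝ => t) F) {s : ℝ}
    (hs : 0 < s) : 1 - lst F s ≤ s * ∫ t, t ∂F := by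
  have h := integral_mono (((integrable_const (1 : ℝ)).sub (hint.const_mul s)))
    (integrable_exp_neg_mul hF hs) (fun t => by
      have := Real.add_one_le_exp (-(s * t))
      simp only [Pi.sub_apply]; linarith)
  simp only [Pi.sub_apply] at h
  rw [integral_sub (integrable_const _) (hint.const_mul s), integral_const_mul] at h
  simp only [integral_const, probReal_univ, smul_eq_mul, mul_one] at h
  rw [lst]; linarith

theorem one_sub_lst_div_lt (hF : ∀ᵐ t ∂F, 0 ≤ t) (hpos : ∃ᶠ t in ae F, 0 < t) {s f : ℝ}
    (hs : 0 < s) (hsf : s < f) : (1 - lst F f) / f < (1 - lst F s) / s := by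
  have hf := hs.trans hsf
  have is := integrable_exp_neg_mul hF hs
  have ie := integrable_exp_neg_mul hF hf
  have strict : ∀ t : ℝ, 0 < t →
      0 < (1 - Real.exp (-(s * t))) / s - (1 - Real.exp (-(f * t))) / f := by
    intro t ht
    -- Strict convexity is applied at -(s t), the convex combination of -(f t) and 0 with weights
    -- s/f and 1 - s/f.
    have hne : -(f * t) ≠ 0 := (neg_neg_of_pos (mul_pos hf ht)).ne
    have h := strictConvexOn_exp.2 (Set.mem_univ (-(f * t))) (Set.mem_univ 0) hne
      (div_pos hs hf) (sub_pos.2 ((div_lt_one hf).2 hsf)) (by ring)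
    have he : (s / f) • (-(f * t)) + (1 - s / f) • (0 : ℝ) = -(s * t) := by
      simp only [smul_eq_mul]; field_simp; ring
    rw [he, Real.exp_zero] at h
    simp only [smul_eq_mul, mul_one] at h
    rw [sub_pos, div_lt_div_iff₀ hf hs]
    have h2 := mul_lt_mul_of_pos_left h hf
    have h3 : f * (s / f * Real.exp (-(f * t)) + (1 - s / f)) =
      s * Real.exp (-(f * t)) + f - s := by field_simp; ring
    linarith
  have is' : Integrable (fun t => (1 - Real.exp (-(s * t))) / s) F :=
    ((integrable_const (1 : ℝ)).sub is).div_const s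
  have ie' : Integrable (fun t => (1 - Real.exp (-(f * t))) / f) F :=
    ((integrable_const (1 : ℝ)).sub ie).div_const f
  have hi : Integrable
      (fun t => (1 - Real.exp (-(s * t))) / s - (1 - Real.exp (-(f * t))) / f) F :=
    is'.sub ie'
  have h := integral_pos_of_frequently_pos (F := F) (hF.mono fun t ht => ?_) hi
    (hpos.mono strict)
  · rw [integral_sub is' ie', integral_div, integral_div,
      integral_sub (integrable_const _) is, integral_sub (integrable_const _) ie] at h
    simp only [integral_const, probReal_univ, smul_eq_mul, mul_one] at h
    exact sub_pos.1 h
  · rcases ht.eq_or_lt with rfl | ht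
    · simp
    · exact (strict t ht).le

theorem blockingProb_eq_of_eq (hF : ∀ᵐ t ∂F, 0 ≤ t) (hr : ∀ i, 0 < r i) {r' : ℕ → ℝ}
    (hr' : ∀ i, 0 < r' i) {m : ℕ} (h : ∀ i < m, r i = r' i) :
    blockingProb F r m = blockingProb F r' m := by
  unfold blockingProb
  refine tendsto_nhds_unique (tendsto_limitProb hF hr (isUpperSet_firstBusy m)) ?_
  refine (tendsto_limitProb hF hr' (isUpperSet_firstBusy m)).congr fun k => ?_
  have hf : ∀ UA UB : Finset ℕ, (∀ i ∈ Set.Iio m, i ∈ UB → i ∈ UA) →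
      Set.indicator {S : Finset ℕ | ∀ i < m, i ∈ S} (fun _ => (1 : ℝ)) UB ≤
        Set.indicator {S : Finset ℕ | ∀ i < m, i ∈ S} (fun _ => 1) UA :=
    fun UA UB hU => indicator_le_indicator_of_imp fun hB i hi => hU i hi (hB i hi)
  exact le_antisymm
    (expAt_le_expAt_of_inter_subset hF hr hr' (isLowerSet_Iio m) (fun i hi => (h i hi).le) hf k
      fun _ _ hi => hi)
    (expAt_le_expAt_of_inter_subset hF hr' hr (isLowerSet_Iio m) (fun i hi => (h i hi).ge) hf k
      fun _ _ hi => hi)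

/-! ### Uniform lower bound for reaching a prefix state -/

/-- The event that, among the first `N` servers, exactly the first `j` are busy. -/
def prefixBusy (j N : ℕ) : Set (Finset ℕ) := {S | ∀ i < N, i ∈ S ↔ i < j}

theorem prod_le_thin_prefixBusy {p : ℕ → ℝ} (hp : ∀ i, 0 ≤ p i ∧ p i ≤ 1) {j N : ℕ}
    (hjN : j ≤ N) {V : Finset ℕ} (hV : ∀ i < j, i ∈ V) :
    (∏ i ∈ Finset.range N with i < j, p i) * ∏ i ∈ Finset.range N with ¬ i < j, (1 - p i) ≤
      thin p V ((prefixBusy j N).indicator fun _ => 1) := by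
  -- The indicator is bounded below by a product of factors, `a` for survivors and `b` for
  -- departures, whose expectation factorises by `thin_prod`. Death is forbidden below `j`, survival
  -- from `j` up to `N`.
  set a : ℕ → ℝ := fun i => if i < j then 1 else if i < N then 0 else 1 with ha
  set b : ℕ → ℝ := fun i => if i < j then 0 else 1 with hb
  set c : ℕ → ℝ := fun i => p i * a i + (1 - p i) * b i with hc
  have ha' : ∀ i, 0 ≤ a i ∧ a i ≤ 1 := by intro i; simp only [ha]; split_ifs <;> norm_num
  have hb' : ∀ i, 0 ≤ b i ∧ b i ≤ 1 := by intro i; simp only [hb]; split_ifs <;> norm_num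
  have hc' : ∀ i, 0 ≤ c i ∧ c i ≤ 1 := by
    intro i
    simp only [hc, ha, hb]
    have := hp i
    split_ifs <;> constructor <;> linarith
  have h1 : (∏ i ∈ Finset.range N with i < j, p i) *
      ∏ i ∈ Finset.range N with ¬ i < j, (1 - p i) = ∏ i ∈ Finset.range N, c i := by
    rw [← Finset.prod_ite]
    refine Finset.prod_congr rfl fun i hi => ?_
    simp only [hc, ha, hb, if_pos (Finset.mem_range.1 hi)]
    split_ifs <;> ring
  -- Servers of `V` from `N` on have factor 1; servers below `N` and outside `V` only contribute
  -- factors at most 1 on the left.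
  have h2 : ∏ i ∈ Finset.range N, c i ≤ ∏ i ∈ V, c i := by
    rw [Finset.prod_subset (Finset.subset_union_left (s₂ := V)),
      ← Finset.sdiff_union_self_eq_union, Finset.prod_union Finset.sdiff_disjoint]
    · exact mul_le_of_le_one_left (Finset.prod_nonneg fun i _ => (hc' i).1)
        (Finset.prod_le_one (fun i _ => (hc' i).1) fun i _ => (hc' i).2)
    · intro i _ hi
      rw [Finset.mem_range] at hi
      have hij : ¬ i < j := fun h => hi (h.trans_le hjN)
      simp [hc, ha, hb, hi, hij]
  rw [h1]
  refine h2.trans ?_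
  rw [← thin_prod]
  refine thin_mono hp fun U hU => ?_
  by_cases hUE : U ∈ prefixBusy j N
  · rw [Set.indicator_of_mem hUE]
    exact mul_le_one₀ (Finset.prod_le_one (fun i _ => (ha' i).1) fun i _ => (ha' i).2)
      (Finset.prod_nonneg fun i _ => (hb' i).1)
      (Finset.prod_le_one (fun i _ => (hb' i).1) fun i _ => (hb' i).2)
  · rw [Set.indicator_of_notMem hUE]
    simp only [prefixBusy, Set.mem_ofPred_eq, not_forall] at hUE
    obtain ⟨i, hiN, hi⟩ := hUE
    by_cases hij : i < j
    · have hiU : i ∉ U := fun h => hi (by simp [h, hij])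
      rw [Finset.prod_eq_zero (s := V \ U) (Finset.mem_sdiff.2 ⟨hV i hij, hiU⟩) (by simp [hb, hij]),
        mul_zero]
    · have hiU : i ∈ U := by by_contra h; exact hi (by simp [h, hij])
      rw [Finset.prod_eq_zero hiU (by simp [ha, hij, hiN]), zero_mul]

theorem exists_pos_le_step_prefixBusy (hF : ∀ᵐ t ∂F, 0 ≤ t) (hpos : ∃ᶠ t in ae F, 0 < t)
    (hr : ∀ i, 0 < r i) {j N : ℕ} (hjN : j ≤ N) :
    ∃ δ > 0, ∀ S, (∀ i < j, i ∈ afterArrival S) →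
      δ ≤ step F r ((prefixBusy j N).indicator fun _ => 1) S := by
  have hi := integrable_prod_survival hF hr (Finset.range N |>.filter (· < j))
    (Finset.range N |>.filter (¬ · < j))
  refine ⟨_, integral_pos_of_frequently_pos (hF.mono fun t ht => ?_) hi (hpos.mono ?_), ?_⟩
  · have h := fun i => exp_mem_unit (hr i) ht
    exact mul_nonneg (Finset.prod_nonneg fun i _ => (h i).1)
      (Finset.prod_nonneg fun i _ => sub_nonneg.2 (h i).2)
  · intro t ht
    refine mul_pos (Finset.prod_pos fun i _ => Real.exp_pos _) (Finset.prod_pos fun i _ => ?_)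
    exact sub_pos.2 (Real.exp_lt_one_iff.2 (neg_neg_of_pos (mul_pos (hr i) ht)))
  · intro S hS
    rw [step_eq_integral hF hr]
    refine integral_mono_ae hi (integrable_thin hF hr _ _) ?_
    filter_upwards [hF] with t ht
    exact prod_le_thin_prefixBusy (fun i => exp_mem_unit (hr i) ht) hjN hS

/-- The prefix is built up one server per arrival: if exactly the first `j` are busy, the next
customer joins server `j`, and with probability bounded below exactly the first `j + 1` remain busy.
The bound does not depend on the starting state. -/
theorem exists_pos_le_expAt_prefixBusy (hF : ∀ᵐ t ∂F, 0 ≤ t) (hpos : ∃ᶠ t in ae F, 0 < t)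
    (hr : ∀ i, 0 < r i) {j N : ℕ} (hjN : j ≤ N) :
    ∃ δ > 0, ∀ k S, δ ≤ expAt F r ((prefixBusy j N).indicator fun _ => 1) (k + j + 1) S := by
  induction j with
  | zero =>
    obtain ⟨δ, hδ, h⟩ := exists_pos_le_step_prefixBusy hF hpos hr hjN
    refine ⟨δ, hδ, fun k S => ?_⟩
    rw [expAt_succ, ← expAt_const hF hr δ (k + 0) S]
    exact expAt_mono hF hr (fun S => h S (by simp)) _ S
  | succ j ih =>
    obtain ⟨ε, hε, ih⟩ := ih (by omega)
    obtain ⟨δ, hδ, h⟩ := exists_pos_le_step_prefixBusy hF hpos hr hjN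
    refine ⟨δ * ε, mul_pos hδ hε, fun k S => ?_⟩
    rw [expAt_succ, ← add_assoc]
    refine (mul_le_mul_of_nonneg_left (ih k S) hδ.le).trans ?_
    rw [← expAt_const_mul]
    refine expAt_mono hF hr (fun T => ?_) _ S
    by_cases hT : T ∈ prefixBusy j N
    · rw [Set.indicator_of_mem hT, mul_one]
      refine h T fun i hi => mem_afterArrival.2 (Or.inr fun l hl => ?_)
      exact (hT l (by omega)).2 (by omega)
    · rw [Set.indicator_of_notMem hT, mul_zero, ← step_const hF hr 0 T]
      exact step_mono hF hr (fun S => Set.indicator_nonneg (fun _ _ => zero_le_one) S) T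

end

/-! ### The exchange: occupancy, delay and feasibility -/

/-- The rate series with the rates of servers `n` and `n + 1` exchanged. -/
def exchange (r : ℕ → ℝ) (n : ℕ) : ℕ → ℝ := r ∘ Equiv.swap n (n + 1)

theorem exchange_left (r : ℕ → ℝ) (n : ℕ) : exchange r n n = r (n + 1) := by simp [exchange]

theorem exchange_right (r : ℕ → ℝ) (n : ℕ) : exchange r n (n + 1) = r n := by simp [exchange]

theorem exchange_of_ne (r : ℕ → ℝ) {n i : ℕ} (h0 : i ≠ n) (h1 : i ≠ n + 1) :
    exchange r n i = r i := by simp [exchange, Equiv.swap_apply_of_ne_of_ne h0 h1]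

theorem exchange_pos {r : ℕ → ℝ} (hr : ∀ i, 0 < r i) (n i : ℕ) : 0 < exchange r n i := hr _

theorem frequently_pos_of_integral_pos {F : Measure ℝ} (hmean : 0 < ∫ t, t ∂F) : ∃ᶠ t in ae F, 0 < t := by
  intro h
  refine hmean.not_ge (integral_nonpos_of_ae ?_)
  filter_upwards [h] with t ht
  exact not_lt.1 ht

section
variable {F : Measure ℝ} [IsProbabilityMeasure F] {r : ℕ → ℝ}

theorem expAt_exchange_le (hF : ∀ᵐ t ∂F, 0 ≤ t) (hr : ∀ i, 0 < r i) {n : ℕ}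
    (hle : r n ≤ r (n + 1)) {fA fB : Finset ℕ → ℝ}
    (hf : ∀ UA UB : Finset ℕ, SwapRel n UA UB → fB UB ≤ fA UA) (k : ℕ) :
    expAt F (exchange r n) fB k ∅ ≤ expAt F r fA k ∅ :=
  expAt_le_expAt_of_swapRel hF hr (exchange_pos hr n) (fun _ => exchange_of_ne r)
    (exchange_right r n) (exchange_left r n) hle hf k (by constructor <;> simp)

theorem limitProb_exchange_le (hF : ∀ᵐ t ∂F, 0 ≤ t) (hr : ∀ i, 0 < r i) {n : ℕ}
    (hle : r n ≤ r (n + 1)) {A : Set (Finset ℕ)} (hA : IsUpperSet A)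
    (h : ∀ UA UB : Finset ℕ, SwapRel n UA UB → UB ∈ A → UA ∈ A) :
    limitProb F (exchange r n) A ≤ limitProb F r A :=
  le_of_tendsto_of_tendsto' (tendsto_limitProb hF (exchange_pos hr n) hA)
    (tendsto_limitProb hF hr hA)
    (expAt_exchange_le hF hr hle fun _ _ hU => indicator_le_indicator_of_imp (h _ _ hU))

theorem blockingProb_exchange_le (hF : ∀ᵐ t ∂F, 0 ≤ t) (hr : ∀ i, 0 < r i) {n : ℕ}
    (hle : r n ≤ r (n + 1)) {m : ℕ} (hm : n + 2 ≤ m) :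
    blockingProb F (exchange r n) m ≤ blockingProb F r m := by
  refine limitProb_exchange_le hF hr hle (isUpperSet_firstBusy m) fun UA UB h hB i hi => ?_
  by_cases h0 : i = n
  · subst h0; exact h.slow (hB _ (by omega))
  by_cases h1 : i = n + 1
  · subst h1; exact h.both (hB _ (by omega)) (hB _ hi)
  exact h.off i h0 h1 (hB i hi)

theorem postProb_exchange_le (hF : ∀ᵐ t ∂F, 0 ≤ t) (hr : ∀ i, 0 < r i) {n : ℕ}
    (hle : r n ≤ r (n + 1)) {i : ℕ} (h0 : i ≠ n) (h1 : i ≠ n + 1) :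
    postProb F (exchange r n) i ≤ postProb F r i :=
  limitProb_exchange_le hF hr hle (isUpperSet_busy_afterArrival i) fun _ _ h =>
    h.afterArrival.off i h0 h1

/-- Both sides concern the slow server. When the exchanged system is in the state `prefixBusy n (n +
2)`, the arrival takes its fast server and leaves the slow one idle, while in the original system
the slow server is busy after the arrival. This state has probability at least `δ` at all late
arrivals, which keeps the inequality strict in the limit. -/
theorem postProb_exchange_lt (hF : ∀ᵐ t ∂F, 0 ≤ t) (hpos : ∃ᶠ t in ae F, 0 < t)
    (hr : ∀ i, 0 < r i) {n : ℕ} (hle : r n ≤ r (n + 1)) :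
    postProb F (exchange r n) (n + 1) < postProb F r n := by
  obtain ⟨δ, hδ, h⟩ := exists_pos_le_expAt_prefixBusy hF hpos (exchange_pos hr n)
    (show n ≤ n + 2 by omega)
  refine lt_of_lt_of_le (lt_add_of_pos_right _ hδ) ?_
  refine le_of_tendsto_of_tendsto' ((((tendsto_add_atTop_iff_nat (n + 1)).2
    (tendsto_limitProb hF (exchange_pos hr n) (isUpperSet_busy_afterArrival (n + 1)))).add_const δ))
    ((tendsto_add_atTop_iff_nat (n + 1)).2
    (tendsto_limitProb hF hr (isUpperSet_busy_afterArrival n))) fun k => ?_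
  refine (add_le_add_right (h k ∅) _).trans ?_
  rw [← add_assoc, ← expAt_add]
  refine expAt_exchange_le hF hr hle (fun UA UB hU => ?_) _
  by_cases hE : UB ∈ prefixBusy n (n + 2)
  · have h1 : n + 1 ∉ afterArrival UB := by
      rw [mem_afterArrival, hE (n + 1) (by omega)]
      rintro (h | h)
      · omega
      · exact lt_irrefl n ((hE n (by omega)).1 (h n (by omega)))
    have h2 : n ∈ afterArrival UA := mem_afterArrival.2 <| Or.inr fun j hj =>
      hU.off j (by omega) (by omega) ((hE j (by omega)).2 hj)
    simp [hE, h1, h2]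
  · rw [Set.indicator_of_notMem hE, add_zero]
    exact indicator_le_indicator_of_imp hU.afterArrival.slow

theorem postProb_add_exchange_le (hF : ∀ᵐ t ∂F, 0 ≤ t) (hr : ∀ i, 0 < r i) {n : ℕ}
    (hle : r n ≤ r (n + 1)) :
    postProb F (exchange r n) n + postProb F (exchange r n) (n + 1) ≤
      postProb F r n + postProb F r (n + 1) := by
  have hl := fun i => tendsto_limitProb hF hr (isUpperSet_busy_afterArrival i)
  have hl' := fun i => tendsto_limitProb hF (exchange_pos hr n) (isUpperSet_busy_afterArrival i)
  refine le_of_tendsto_of_tendsto' ((hl' n).add (hl' (n + 1))) ((hl n).add (hl (n + 1)))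
    fun k => ?_
  rw [← expAt_add, ← expAt_add]
  refine expAt_exchange_le hF hr hle (fun UA UB hU => ?_) _
  have h1 := hU.afterArrival.slow
  have h2 := hU.afterArrival.fast
  have h3 := hU.afterArrival.both
  simp only [Set.indicator_apply, Set.mem_ofPred_eq]
  by_cases c1 : n ∈ afterArrival UB <;> by_cases c2 : n + 1 ∈ afterArrival UB <;>
    by_cases c3 : n ∈ afterArrival UA <;> by_cases c4 : n + 1 ∈ afterArrival UA <;>
    simp_all

/-- Mean delay contributed by server `i` per arrival, through rate conservation. -/
theorem joinProb_div_eq (hF : ∀ᵐ t ∂F, 0 ≤ t) (hr : ∀ i, 0 < r i) (i : ℕ) :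
    joinProb F r i / r i = (1 - lst F (r i)) / r i * postProb F r i := by
  rw [joinProb_eq hF hr]; ring

theorem joinProb_div_nonneg (hF : ∀ᵐ t ∂F, 0 ≤ t) (hr : ∀ i, 0 < r i) (i : ℕ) :
    0 ≤ joinProb F r i / r i := by
  rw [joinProb_div_eq hF hr]
  exact mul_nonneg (div_nonneg (sub_nonneg.2 (lst_le_one hF (hr i))) (hr i).le)
    (limitProb_nonneg hF hr (isUpperSet_busy_afterArrival i))

theorem joinProb_div_exchange_pair_lt (hF : ∀ᵐ t ∂F, 0 ≤ t) (hpos : ∃ᶠ t in ae F, 0 < t)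
    (hr : ∀ i, 0 < r i) {n : ℕ} (hlt : r n < r (n + 1)) :
    joinProb F (exchange r n) n / exchange r n n +
        joinProb F (exchange r n) (n + 1) / exchange r n (n + 1) <
      joinProb F r n / r n + joinProb F r (n + 1) / r (n + 1) := by
  rw [joinProb_div_eq hF hr, joinProb_div_eq hF hr, joinProb_div_eq hF (exchange_pos hr n),
    joinProb_div_eq hF (exchange_pos hr n), exchange_left, exchange_right]
  have hg := one_sub_lst_div_lt hF hpos (hr n) hlt
  have hg0 : 0 ≤ (1 - lst F (r (n + 1))) / r (n + 1) :=
    div_nonneg (sub_nonneg.2 (lst_le_one hF (hr _))) (hr _).le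
  -- With b for the original and b' for the exchanged system, s = `r n` and f = `r (n + 1)`, the
  -- difference is (g(s) - g(f))(b_n - b'_{n+1}) + g(f)(b_n + b_{n+1} - b'_n - b'_{n+1}).
  nlinarith [mul_pos (sub_pos.2 hg) (sub_pos.2 (postProb_exchange_lt hF hpos hr hlt.le)),
    mul_nonneg hg0 (sub_nonneg.2 (postProb_add_exchange_le hF hr hlt.le))]

theorem joinProb_div_exchange_le (hF : ∀ᵐ t ∂F, 0 ≤ t) (hr : ∀ i, 0 < r i) {n : ℕ}
    (hle : r n ≤ r (n + 1)) {i : ℕ} (h0 : i ≠ n) (h1 : i ≠ n + 1) :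
    joinProb F (exchange r n) i / exchange r n i ≤ joinProb F r i / r i := by
  rw [joinProb_div_eq hF hr, joinProb_div_eq hF (exchange_pos hr n), exchange_of_ne r h0 h1]
  exact mul_le_mul_of_nonneg_left (postProb_exchange_le hF hr hle h0 h1)
    (div_nonneg (sub_nonneg.2 (lst_le_one hF (hr i))) (hr i).le)

theorem expectedDelay_exchange_lt (hF : ∀ᵐ t ∂F, 0 ≤ t) (hpos : ∃ᶠ t in ae F, 0 < t)
    (hr : ∀ i, 0 < r i) (hfin : expectedDelay F r < ⊤) {n : ℕ} (hlt : r n < r (n + 1)) :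
    expectedDelay F (exchange r n) < expectedDelay F r := by
  have split : ∀ g : ℕ → ENNReal, ∑' i, g i =
      (g n + g (n + 1)) + ∑' i, if i = n + 1 then 0 else if i = n then 0 else g i := by
    intro g
    rw [ENNReal.tsum_eq_add_tsum_ite n, ENNReal.tsum_eq_add_tsum_ite (n + 1)]
    simp only [Nat.succ_ne_self, if_false, add_assoc]
    congr! 6
  unfold expectedDelay at *
  rw [split] at hfin ⊢
  rw [split fun i => ENNReal.ofReal (joinProb F r i / r i)]
  refine ENNReal.add_lt_add_of_lt_of_le ?_ ?_ ?_
  -- A strict inequality survives adding the other servers only if their sum is finite; this is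
  -- where the finite value of the program enters.
  · refine ne_top_of_le_ne_top hfin.ne (le_trans (ENNReal.tsum_le_tsum fun i => ?_) le_add_self)
    split_ifs with h1 h0
    exacts [le_rfl, le_rfl, ENNReal.ofReal_le_ofReal (joinProb_div_exchange_le hF hr hlt.le h0 h1)]
  · rw [← ENNReal.ofReal_add (joinProb_div_nonneg hF hr _) (joinProb_div_nonneg hF hr _),
      ← ENNReal.ofReal_add (joinProb_div_nonneg hF (exchange_pos hr n) _)
        (joinProb_div_nonneg hF (exchange_pos hr n) _)]
    have h := joinProb_div_exchange_pair_lt hF hpos hr hlt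
    refine (ENNReal.ofReal_lt_ofReal_iff (lt_of_le_of_lt ?_ h)).2 h
    exact add_nonneg (joinProb_div_nonneg hF (exchange_pos hr n) _)
      (joinProb_div_nonneg hF (exchange_pos hr n) _)
  · refine ENNReal.tsum_le_tsum fun i => ?_
    split_ifs with h1 h0
    exacts [le_rfl, le_rfl, ENNReal.ofReal_le_ofReal (joinProb_div_exchange_le hF hr hlt.le h0 h1)]

/-- For `m ≤ n` neither side of the constraint changes; for `m ≥ n + 2` the tail is unchanged and
the blocking probability does not grow. Only `m = n + 1` loses capacity. -/
theorem Feasible.exchange (hF : ∀ᵐ t ∂F, 0 ≤ t) (hint : Integrable (fun t : ℝ => t) F)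
    {lam cap : ℝ} (hlam : 0 < lam) (hmean : ∫ t, t ∂F = 1 / lam)
    (h : Feasible F lam cap r) {n : ℕ} (hle : r n ≤ r (n + 1)) :
    Feasible F lam cap (exchange r n) := by
  have hr := h.pos
  have hr' := exchange_pos hr n
  have htot : HasSum (OrderedServers.exchange r n) cap :=
    (Equiv.hasSum_iff (Equiv.swap n (n + 1))).2 h.total
  have tail : ∀ m, n + 2 ≤ m →
      ∑' i, OrderedServers.exchange r n (m + i) = ∑' i, r (m + i) := fun m hm =>
    tsum_congr fun i => exchange_of_ne r (by omega) (by omega)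
  have tail_succ : ∀ {f : ℕ → ℝ}, Summable f → ∀ m,
      ∑' i, f (m + i) = f m + ∑' i, f (m + 1 + i) := by
    intro f hf m
    have hs : Summable fun i => f (m + i) := by
      simpa only [add_comm] using (summable_nat_add_iff m).2 hf
    rw [hs.tsum_eq_zero_add]
    simp only [add_zero, add_assoc, add_comm 1]
  have low : ∀ m ≤ n, ∑' i, OrderedServers.exchange r n (m + i) = ∑' i, r (m + i) := by
    intro m hm
    induction hd : n - m generalizing m with
    | zero =>
      obtain rfl : m = n := by omega
      rw [tail_succ htot.summable, tail_succ htot.summable, tail_succ h.total.summable,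
        tail_succ h.total.summable, exchange_left, exchange_right, tail _ le_rfl]
      ring
    | succ d ih =>
      rw [tail_succ htot.summable, tail_succ h.total.summable,
        ih (m + 1) (by omega) (by omega),
        exchange_of_ne r (by omega) (by omega)]
  refine ⟨hr', htot, fun m hm => ?_⟩
  rcases lt_trichotomy m (n + 1) with hmn | rfl | hmn
  · rw [low m (by omega), blockingProb_eq_of_eq hF hr' hr fun i hi =>
      exchange_of_ne r (by omega) (by omega)]
    exact h.stable m hm
  -- The constraint at `n + 2` is used instead: the blocking probability at `n + 1` exceeds that at
  -- `n + 2` by the joining probability of server `n + 1`, which now has rate `r n`. Its arrival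
  -- flow is at most `r n`, because 1 - φ(s) ≤ s / `lam`, and `r n` is also what the tail gains.
  · rw [tail_succ htot.summable, exchange_right, tail _ le_rfl]
    have h1 := h.stable (n + 2) (by omega)
    have h2 := mul_le_mul_of_nonneg_left (blockingProb_exchange_le hF hr hle le_rfl) hlam.le
    have h3 := (tendsto_joinProb hF hr' (n + 1)).2
    have h4 : lam * joinProb F (OrderedServers.exchange r n) (n + 1) ≤ r n := by
      rw [joinProb_eq hF hr', exchange_right]
      have h5 := one_sub_lst_le hF hint (hr n)
      have h6 := mul_le_of_le_one_right (sub_nonneg.2 (lst_le_one hF (hr n)))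
        (limitProb_le_one hF hr' (isUpperSet_busy_afterArrival (n + 1)))
      rw [hmean] at h5
      calc lam * ((1 - lst F (r n)) * postProb F (OrderedServers.exchange r n) (n + 1))
          ≤ lam * (r n * (1 / lam)) := mul_le_mul_of_nonneg_left (h6.trans h5) hlam.le
        _ = r n := by field_simp
    rw [h3, mul_sub] at h4
    linarith
  · rw [tail m hmn]
    exact (mul_le_mul_of_nonneg_left (blockingProb_exchange_le hF hr hle hmn) hlam.le).trans_lt
      (h.stable m hm)

end

end OrderedServers

theorem mainTheorem7 (F : MeasureTheory.Measure ℝ) [MeasureTheory.IsProbabilityMeasure F]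
    (hF : ∀ᵐ t ∂F, 0 ≤ t) (hint : MeasureTheory.Integrable (fun t : ℝ => t) F)
    (lam cap : ℝ) (hlam : 0 < lam) (hmean : ∫ t, t ∂F = 1 / lam) (hcap : lam < cap)
    (r : ℕ → ℝ) (hr : OrderedServers.IsOptimal F lam cap r) :
    Antitone r := by
  refine antitone_nat_of_succ_le fun n => ?_
  by_contra! hlt
  have hpos := OrderedServers.frequently_pos_of_integral_pos (F := F)
    (hmean ▸ one_div_pos.2 hlam)
  exact (hr.le _ (hr.feasible.exchange hF hint hlam hmean hlt.le)).not_gt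
    (OrderedServers.expectedDelay_exchange_lt hF hpos hr.feasible.pos hr.finite hlt)
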